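/- Let $F$ be Thompson's group: the group of all strictly increasing piecewise linear homeomorphisms of $[0,1]$ that are differentiable except at finitely many dyadic rational numbers and whose derivatives, where they exist, are integer powers of $2$. Let $x_0,x_1\in F$ be its standard generators $$x_0(t)=\begin{cases}\frac t2,&0\le t\le\frac12,\\ t-\frac14,&\frac12\le t\le\frac34,\\ 2t-1,&\frac34\le t\le1,\end{cases}\qquad x_1(t)=\begin{cases}t,&0\le t\le\frac12,\\ \frac t2+\frac14,&\frac12\le t\le\frac34,\\ t-\frac18,&\frac34\le t\le\frac78,\\ 2t-1,&\frac78\le t\le1.\end{cases}$$ For $x\in[0,1]$, the Schreier graph $\Gamma_x$ of the action of $F$ on the orbit of $x$ is the oriented labeled graph whose vertices are the points of the $F$-orbit of $x$, with an arrow labeled $s\in\{x_0,x_1\}$ from $y$ to $z$ if and only if $s(y)=z$. Then for every $x\in(0,1)$ the graph $\Gamma_x$ (regarded as an undirected graph) has infinitely many ends, where an end is a compatible choice, for each finite set $K$ of vertices, of a connected component of the complement of $K$. -/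

import Mathlib

open Topology

namespace Thompson

/-- Dyadic rational numbers, as real numbers. -/
def IsDyadic (r : ℝ) : Prop := ∃ (m : ℤ) (n : ℕ), r = (m : ℝ) / 2 ^ n

/-- `f` is a strictly increasing homeomorphism of `[0,1]`, and there is a finite set `B` of dyadic
rationals such that, around each point of `[0,1]` outside `B`, `f` is affine with slope an
integer power of `2`. Hence `f` is piecewise linear, it can fail to be differentiable only at the
points of `B`, and its derivatives are integer powers of `2`. -/
def IsThompson (f : unitInterval ≃ₜ unitInterval) : Prop :=
  StrictMono f ∧ ∃ B : Finset ℝ, (∀ b ∈ B, IsDyadic b) ∧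
    ∀ t : unitInterval, (t : ℝ) ∉ B →
      ∃ (k : ℤ) (c : ℝ), ∀ᶠ s : unitInterval in 𝓝 t, (f s : ℝ) = (2 : ℝ) ^ k * (s : ℝ) + c

lemma IsDyadic.add {a b : ℝ} (ha : IsDyadic a) (hb : IsDyadic b) : IsDyadic (a + b) := by
  obtain ⟨m, n, rfl⟩ := ha
  obtain ⟨p, q, rfl⟩ := hb
  refine ⟨m * 2 ^ q + p * 2 ^ n, n + q, ?_⟩
  push_cast
  field_simp
  ring

lemma IsDyadic.neg {a : ℝ} (ha : IsDyadic a) : IsDyadic (-a) := by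
  obtain ⟨m, n, rfl⟩ := ha
  exact ⟨-m, n, by push_cast; ring⟩

lemma IsDyadic.zpow_mul {a : ℝ} (ha : IsDyadic a) (k : ℤ) : IsDyadic ((2 : ℝ) ^ k * a) := by
  obtain ⟨m, n, rfl⟩ := ha
  obtain ⟨j, rfl | rfl⟩ := Int.eq_nat_or_neg k
  · exact ⟨2 ^ j * m, n, by push_cast; rw [zpow_natCast]; ring⟩
  · refine ⟨m, j + n, ?_⟩
    rw [zpow_neg, zpow_natCast, pow_add]
    field_simp

lemma affine_on_Ioo {f : unitInterval ≃ₜ unitInterval} {B : Finset ℝ}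
    (hB : ∀ t : unitInterval, (t : ℝ) ∉ B →
      ∃ (k : ℤ) (c : ℝ), ∀ᶠ s : unitInterval in 𝓝 t, (f s : ℝ) = (2 : ℝ) ^ k * (s : ℝ) + c)
    {a t : unitInterval} (hat : a < t) (h : ∀ s ∈ Set.Ioo a t, (s : ℝ) ∉ B) :
    ∃ k : ℤ, (f t : ℝ) = (f a : ℝ) + (2 : ℝ) ^ k * ((t : ℝ) - (a : ℝ)) := by
  obtain ⟨m, hm⟩ := exists_between hat
  obtain ⟨k, c, hkc⟩ := hB m (h m hm)
  set u : Set unitInterval :=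
    {s | ∀ᶠ r : unitInterval in 𝓝 s, (f r : ℝ) = (2 : ℝ) ^ k * (r : ℝ) + c} with hu
  have hsub : Set.Ioo a t ⊆ u := by
    refine isPreconnected_Ioo.subset_of_closure_inter_subset
      isOpen_setOfPred_eventually_nhds ⟨m, hm, hkc⟩ ?_
    rintro s ⟨hs, hsI⟩
    obtain ⟨k', c', hk'⟩ := hB s (h s hsI)
    obtain ⟨s', hs'u, hs'⟩ :=
      ((mem_closure_iff_frequently.1 hs).and_eventually hk'.eventually_nhds).exists
    have hb : ∀ᶠ r : unitInterval in 𝓝 s',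
        (2 : ℝ) ^ k * (r : ℝ) + c = (2 : ℝ) ^ k' * (r : ℝ) + c' := by
      filter_upwards [hs'u, hs'] with r h1 h2
      rw [← h1, h2]
    obtain ⟨r, hr, hne⟩ := ((hb.filter_mono nhdsWithin_le_nhds).and
      (self_mem_nhdsWithin : {s'}ᶜ ∈ 𝓝[≠] s')).exists
    have h0 := hb.self_of_nhds
    have hne' : (r : ℝ) - (s' : ℝ) ≠ 0 := by
      intro h3
      exact hne (Subtype.ext (by linarith))
    have hk : (2 : ℝ) ^ k = (2 : ℝ) ^ k' := by
      apply mul_right_cancel₀ hne'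
      linarith
    have hc : c = c' := by
      rw [hk] at h0
      linarith
    change ∀ᶠ r : unitInterval in 𝓝 s, (f r : ℝ) = (2 : ℝ) ^ k * (r : ℝ) + c
    rw [hk, hc]
    exact hk'
  have hcl : Set.Icc a t ⊆ {s : unitInterval | (f s : ℝ) = (2 : ℝ) ^ k * (s : ℝ) + c} := by
    rw [← closure_Ioo hat.ne]
    refine closure_minimal (fun s hs => (hsub hs).self_of_nhds) (isClosed_eq ?_ ?_)
    · exact continuous_subtype_val.comp f.continuous
    · fun_prop
  have h1 : (f a : ℝ) = (2 : ℝ) ^ k * (a : ℝ) + c := hcl (Set.left_mem_Icc.2 hat.le)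
  have h2 : (f t : ℝ) = (2 : ℝ) ^ k * (t : ℝ) + c := hcl (Set.right_mem_Icc.2 hat.le)
  exact ⟨k, by rw [h1, h2]; ring⟩

lemma map_zero_of_strictMono {f : unitInterval ≃ₜ unitInterval} (hf : StrictMono f) :
    f 0 = 0 := by
  refine le_antisymm ?_ (show (0 : unitInterval) ≤ f 0 from (f 0).2.1)
  calc f 0 ≤ f (f.symm 0) := hf.monotone (f.symm 0).2.1
    _ = 0 := f.apply_symm_apply 0

lemma IsThompson.isDyadic_apply {f : unitInterval ≃ₜ unitInterval} (hf : IsThompson f)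
    (t : unitInterval) (ht : IsDyadic t) : IsDyadic (f t) := by
  obtain ⟨hmono, B, hBd, hB⟩ := hf
  obtain ⟨N, hN⟩ : ∃ N, (B.filter (fun b => b < (t : ℝ))).card = N := ⟨_, rfl⟩
  induction N using Nat.strong_induction_on generalizing t with
  | _ N ih =>
    have main : ∀ a : unitInterval, IsDyadic (f a) → IsDyadic a → a < t →
        (∀ s ∈ Set.Ioo a t, (s : ℝ) ∉ B) → IsDyadic (f t) := by
      intro a hfa ha hat h
      obtain ⟨k, hk⟩ := affine_on_Ioo hB hat h
      rw [hk]
      exact hfa.add ((ht.add ha.neg).zpow_mul k)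
    have hf0 : IsDyadic (f 0) := by
      rw [map_zero_of_strictMono hmono]
      exact ⟨0, 0, by simp⟩
    have h0 : IsDyadic ((0 : unitInterval) : ℝ) := ⟨0, 0, by simp⟩
    by_cases hex : ∃ b ∈ B, 0 < b ∧ b < (t : ℝ)
    · have hne : (B.filter (fun b => 0 < b ∧ b < (t : ℝ))).Nonempty := by
        obtain ⟨b, hb, h⟩ := hex
        exact ⟨b, by simp [hb, h]⟩
      obtain ⟨b, hb, hmax⟩ := Finset.exists_max_image _ id hne
      obtain ⟨hbB, hb0, hbt⟩ := Finset.mem_filter.1 hb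
      let a : unitInterval := ⟨b, hb0.le, hbt.le.trans t.2.2⟩
      refine main a (ih _ ?_ a (hBd b hbB) rfl) (hBd b hbB) hbt ?_
      · rw [← hN]
        apply Finset.card_lt_card
        refine ⟨?_, ?_⟩
        · intro z hz
          simp only [Finset.mem_filter] at hz ⊢
          exact ⟨hz.1, hz.2.trans hbt⟩
        · intro hss
          have : b ∈ B.filter (fun z => z < (a : ℝ)) := hss (by simp [hbB, hbt])
          simp [a] at this
      · intro s hs hsB
        have h1 : b < (s : ℝ) := hs.1
        have h2 : (s : ℝ) < t := hs.2
        have := hmax s (by simp only [Finset.mem_filter]; exact ⟨hsB, hb0.trans h1, h2⟩)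
        simp only [id] at this
        linarith
    · rcases eq_or_lt_of_le t.2.1 with h | h
      · have : t = 0 := Subtype.ext h.symm
        rw [this]
        exact hf0
      · refine main 0 hf0 h0 h ?_
        intro s hs hsB
        exact hex ⟨s, hsB, hs.1, hs.2⟩

lemma IsThompson.inv {f : unitInterval ≃ₜ unitInterval} (hf : IsThompson f) :
    IsThompson f⁻¹ := by
  have hdy := hf.isDyadic_apply
  obtain ⟨hmono, B, hBd, hB⟩ := hf
  classical
  refine ⟨?_, (B.subtype (· ∈ unitInterval)).image (fun b => (f b : ℝ)), ?_, ?_⟩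
  · intro a b hab
    change f.symm a < f.symm b
    rw [← hmono.lt_iff_lt]
    simpa using hab
  · intro b hb
    obtain ⟨z, hz, rfl⟩ := Finset.mem_image.1 hb
    exact hdy z (hBd _ (by simpa using hz))
  · intro t ht
    have h1 : ((f.symm t : unitInterval) : ℝ) ∉ B := by
      intro h
      apply ht
      exact Finset.mem_image.2 ⟨f.symm t, Finset.mem_subtype.2 h, by simp⟩
    obtain ⟨k, c, hkc⟩ := hB _ h1
    refine ⟨-k, -((2 : ℝ) ^ (-k) * c), ?_⟩
    filter_upwards [f.symm.continuous.continuousAt.eventually hkc] with s hs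
    change ((f.symm s : unitInterval) : ℝ) = _
    rw [f.apply_symm_apply] at hs
    rw [hs, zpow_neg]
    field_simp
    ring

lemma IsThompson.mul {f g : unitInterval ≃ₜ unitInterval} (hf : IsThompson f)
    (hg : IsThompson g) : IsThompson (f * g) := by
  have hdy := hg.inv.isDyadic_apply
  obtain ⟨hfm, B, hBd, hB⟩ := hf
  obtain ⟨hgm, C, hCd, hC⟩ := hg
  classical
  refine ⟨hfm.comp hgm,
    C ∪ (B.subtype (· ∈ unitInterval)).image (fun b => (g.symm b : ℝ)), ?_, ?_⟩
  · intro b hb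
    rcases Finset.mem_union.1 hb with hb | hb
    · exact hCd b hb
    · obtain ⟨z, hz, rfl⟩ := Finset.mem_image.1 hb
      exact hdy z (hBd _ (by simpa using hz))
  · intro t ht
    rw [Finset.mem_union, not_or] at ht
    obtain ⟨ht1, ht2⟩ := ht
    have h1 : ((g t : unitInterval) : ℝ) ∉ B := by
      intro h
      apply ht2
      exact Finset.mem_image.2 ⟨g t, Finset.mem_subtype.2 h, by simp⟩
    obtain ⟨k, c, hkc⟩ := hB _ h1
    obtain ⟨l, d, hld⟩ := hC t ht1
    refine ⟨k + l, (2 : ℝ) ^ k * d + c, ?_⟩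
    filter_upwards [g.continuous.continuousAt.eventually hkc, hld] with s hs1 hs2
    change ((f (g s) : unitInterval) : ℝ) = _
    rw [hs1, hs2, zpow_add₀ two_ne_zero]
    ring

lemma IsThompson.one : IsThompson 1 := by
  refine ⟨strictMono_id, ∅, by simp, fun t _ => ⟨0, 0, Filter.Eventually.of_forall fun s => ?_⟩⟩
  change (s : ℝ) = _
  simp

end Thompson

/-- Thompson's group `F`, as a group of homeomorphisms of `[0,1]` under composition. -/
def ThompsonF : Subgroup (unitInterval ≃ₜ unitInterval) where
  carrier := {f | Thompson.IsThompson f}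
  mul_mem' := Thompson.IsThompson.mul
  one_mem' := Thompson.IsThompson.one
  inv_mem' := Thompson.IsThompson.inv

namespace ThompsonF

/-- The action of `F` on `[0,1]` by evaluation. -/
instance : MulAction ThompsonF unitInterval where
  smul f t := (f : unitInterval ≃ₜ unitInterval) t
  one_smul _ := rfl
  mul_smul _ _ _ := rfl

noncomputable section

/-- The map `x₀` on `[0,1]`. -/
def x0Fun (t : unitInterval) : unitInterval :=
  ⟨if (t : ℝ) ≤ 1 / 2 then t / 2 else if (t : ℝ) ≤ 3 / 4 then t - 1 / 4 else 2 * t - 1, by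
    have h0 := t.2.1
    have h1 := t.2.2
    split_ifs <;> constructor <;> linarith⟩

/-- The inverse of `x₀`. -/
def x0Inv (t : unitInterval) : unitInterval :=
  ⟨if (t : ℝ) ≤ 1 / 4 then 2 * t else if (t : ℝ) ≤ 1 / 2 then t + 1 / 4 else (t + 1) / 2, by
    have h0 := t.2.1
    have h1 := t.2.2
    split_ifs <;> constructor <;> linarith⟩

/-- The map `x₁` on `[0,1]`. -/
def x1Fun (t : unitInterval) : unitInterval :=
  ⟨if (t : ℝ) ≤ 1 / 2 then t else if (t : ℝ) ≤ 3 / 4 then t / 2 + 1 / 4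
    else if (t : ℝ) ≤ 7 / 8 then t - 1 / 8 else 2 * t - 1, by
    have h0 := t.2.1
    have h1 := t.2.2
    split_ifs <;> constructor <;> linarith⟩

/-- The inverse of `x₁`. -/
def x1Inv (t : unitInterval) : unitInterval :=
  ⟨if (t : ℝ) ≤ 1 / 2 then t else if (t : ℝ) ≤ 5 / 8 then 2 * t - 1 / 2
    else if (t : ℝ) ≤ 3 / 4 then t + 1 / 8 else (t + 1) / 2, by
    have h0 := t.2.1
    have h1 := t.2.2
    split_ifs <;> constructor <;> linarith⟩

lemma x0Fun_strictMono : StrictMono x0Fun := by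
  intro a b hab
  have hab' : (a : ℝ) < b := hab
  rw [← Subtype.coe_lt_coe]
  simp only [x0Fun]
  split_ifs <;> linarith

lemma x0Fun_rightInverse : Function.RightInverse x0Inv x0Fun := by
  intro t
  apply Subtype.ext
  simp only [x0Fun, x0Inv]
  split_ifs <;> linarith

lemma x1Fun_strictMono : StrictMono x1Fun := by
  intro a b hab
  have hab' : (a : ℝ) < b := hab
  rw [← Subtype.coe_lt_coe]
  simp only [x1Fun]
  split_ifs <;> linarith

lemma x1Fun_rightInverse : Function.RightInverse x1Inv x1Fun := by
  intro t
  apply Subtype.ext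
  simp only [x1Fun, x1Inv]
  split_ifs <;> linarith

/-- `x₀` as a homeomorphism of `[0,1]`. -/
def x0Homeo : unitInterval ≃ₜ unitInterval :=
  (x0Fun_strictMono.orderIsoOfRightInverse x0Fun x0Inv x0Fun_rightInverse).toHomeomorph

/-- `x₁` as a homeomorphism of `[0,1]`. -/
def x1Homeo : unitInterval ≃ₜ unitInterval :=
  (x1Fun_strictMono.orderIsoOfRightInverse x1Fun x1Inv x1Fun_rightInverse).toHomeomorph

lemma eventually_lt_coe {t : unitInterval} {r : ℝ} (h : r < (t : ℝ)) :
    ∀ᶠ s : unitInterval in 𝓝 t, r < (s : ℝ) :=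
  continuous_subtype_val.continuousAt.eventually (lt_mem_nhds h)

lemma eventually_coe_lt {t : unitInterval} {r : ℝ} (h : (t : ℝ) < r) :
    ∀ᶠ s : unitInterval in 𝓝 t, (s : ℝ) < r :=
  continuous_subtype_val.continuousAt.eventually (gt_mem_nhds h)

lemma x0Homeo_mem : x0Homeo ∈ ThompsonF := by
  refine ⟨x0Fun_strictMono, {1 / 2, 3 / 4}, ?_, ?_⟩
  · intro b hb
    simp only [Finset.mem_insert, Finset.mem_singleton] at hb
    rcases hb with rfl | rfl
    · exact ⟨1, 1, by norm_num⟩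
    · exact ⟨3, 2, by norm_num⟩
  · intro t ht
    simp only [Finset.mem_insert, Finset.mem_singleton, not_or] at ht
    obtain ⟨h1, h2⟩ := ht
    change ∃ (k : ℤ) (c : ℝ), ∀ᶠ s : unitInterval in 𝓝 t,
      ((x0Fun s : unitInterval) : ℝ) = (2 : ℝ) ^ k * (s : ℝ) + c
    rcases lt_or_gt_of_ne h1 with h1 | h1
    · refine ⟨-1, 0, ?_⟩
      filter_upwards [eventually_coe_lt h1] with s hs
      simp only [x0Fun, zpow_neg_one]
      split_ifs <;> linarith
    · rcases lt_or_gt_of_ne h2 with h2 | h2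
      · refine ⟨0, -(1 / 4), ?_⟩
        filter_upwards [eventually_lt_coe h1, eventually_coe_lt h2] with s hs hs'
        simp only [x0Fun, zpow_zero]
        split_ifs <;> linarith
      · refine ⟨1, -1, ?_⟩
        filter_upwards [eventually_lt_coe h2] with s hs
        simp only [x0Fun, zpow_one]
        split_ifs <;> linarith

lemma x1Homeo_mem : x1Homeo ∈ ThompsonF := by
  refine ⟨x1Fun_strictMono, {1 / 2, 3 / 4, 7 / 8}, ?_, ?_⟩
  · intro b hb
    simp only [Finset.mem_insert, Finset.mem_singleton] at hb
    rcases hb with rfl | rfl | rfl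
    · exact ⟨1, 1, by norm_num⟩
    · exact ⟨3, 2, by norm_num⟩
    · exact ⟨7, 3, by norm_num⟩
  · intro t ht
    simp only [Finset.mem_insert, Finset.mem_singleton, not_or] at ht
    obtain ⟨h1, h2, h3⟩ := ht
    change ∃ (k : ℤ) (c : ℝ), ∀ᶠ s : unitInterval in 𝓝 t,
      ((x1Fun s : unitInterval) : ℝ) = (2 : ℝ) ^ k * (s : ℝ) + c
    rcases lt_or_gt_of_ne h1 with h1 | h1
    · refine ⟨0, 0, ?_⟩
      filter_upwards [eventually_coe_lt h1] with s hs
      simp only [x1Fun, zpow_zero]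
      split_ifs <;> linarith
    · rcases lt_or_gt_of_ne h2 with h2 | h2
      · refine ⟨-1, 1 / 4, ?_⟩
        filter_upwards [eventually_lt_coe h1, eventually_coe_lt h2] with s hs hs'
        simp only [x1Fun, zpow_neg_one]
        split_ifs <;> linarith
      · rcases lt_or_gt_of_ne h3 with h3 | h3
        · refine ⟨0, -(1 / 8), ?_⟩
          filter_upwards [eventually_lt_coe h2, eventually_coe_lt h3] with s hs hs'
          simp only [x1Fun, zpow_zero]
          split_ifs <;> linarith
        · refine ⟨1, -1, ?_⟩
          filter_upwards [eventually_lt_coe h3] with s hs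
          simp only [x1Fun, zpow_one]
          split_ifs <;> linarith

/-- The standard generators `x₀, x₁` of `F`, which label the edges of the Schreier graph. -/
def gen : Fin 2 → ThompsonF :=
  ![⟨x0Homeo, x0Homeo_mem⟩, ⟨x1Homeo, x1Homeo_mem⟩]

end

/-- The Schreier graph of `x`: the vertices are the points of the `F`-orbit of `x`, and for each
generator `s` there is an arrow labelled `s` from each vertex `y` to `s(y)`. -/
abbrev SchreierGraphOf (x : unitInterval) : Type :=
  Quiver.SchreierGraph (MulAction.orbit ThompsonF x) gen

/-- The undirected graph underlying the Schreier graph of `x` (labels, directions, loops and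
multiplicities of edges, which do not affect the ends, are forgotten). -/
def underlyingGraph (x : unitInterval) : SimpleGraph (SchreierGraphOf x) :=
  SimpleGraph.fromRel fun a b => Nonempty (a ⟶ b)

end ThompsonF

/-!
A proper ray staying in a set `S` of vertices with finite outer boundary defines an end that lives
in `S`, so infinitely many disjoint such sets give infinitely many ends.

In the Schreier graph these sets are half-lines: `x₁` fixes `(0, 1/2]` pointwise, so for `w` in
`(1/4, 1/2]` the points `w, x₀ w, x₀² w, …` are joined to other vertices only through `x₀⁻¹ w`.
Since `x₀` maps `(0, 1/2]` into `(0, 1/4]`, distinct `w` give disjoint half-lines. Finally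
`(1/4, 1/2]` contains infinitely many points of every orbit in `(0, 1)`: some power of `x₀` moves a
given point into `(1/2, 3/4]`, its iterates under `x₁` decrease strictly inside that interval, and
`x₀` maps `(1/2, 3/4]` to `(1/4, 1/2]`.
-/

open Set Filter

section MonotoneAction

variable {G α : Type*} [Group G] [ConditionallyCompleteLinearOrder α] [MulAction G α]
  [CovariantClass G α HSMul.hSMul LE.le] {g : G} {a c : α}

lemma smul_lt_smul_of_lt (g : G) (h : a < c) : g • a < g • c :=
  (smul_mono_right g).strictMono_of_injective (MulAction.injective g) h

lemma exists_pow_smul_lt (h : ∀ t ∈ Icc c a, g • t < t) : ∃ n : ℕ, g ^ n • a < c := by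
  by_contra! hc
  have hbdd : BddBelow (range fun n : ℕ => g ^ n • a) := ⟨c, forall_mem_range.2 hc⟩
  -- The infimum `s` of the forward orbit cannot satisfy `s < g⁻¹ • s`.
  set s := ⨅ n : ℕ, g ^ n • a
  have hsa : s ≤ a := (ciInf_le hbdd 0).trans_eq (by rw [pow_zero, one_smul])
  have hs : s < g⁻¹ • s := by
    simpa only [inv_smul_smul] using smul_lt_smul_of_lt g⁻¹ (h s ⟨le_ciInf hc, hsa⟩)
  obtain ⟨n, hn⟩ := exists_lt_of_ciInf_lt hs
  have hlt : g ^ (n + 1) • a < s := by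
    simpa only [pow_succ', mul_smul, smul_inv_smul] using smul_lt_smul_of_lt g hn
  exact (ciInf_le hbdd (n + 1)).not_gt hlt

lemma exists_mem_Ioc_pow_smul (hca : c ≤ a) (h : ∀ t ∈ Icc c a, g • t < t) :
    ∃ n : ℕ, c ∈ Ioc (g ^ (n + 1) • a) (g ^ n • a) := by
  classical
  have hex := exists_pow_smul_lt h
  obtain ⟨n, hn⟩ : ∃ n, Nat.find hex = n + 1 :=
    Nat.exists_eq_succ_of_ne_zero fun h0 => by
      have hlt := Nat.find_spec hex
      rw [h0, pow_zero, one_smul] at hlt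
      exact hca.not_gt hlt
  exact ⟨n, hn ▸ Nat.find_spec hex, not_lt.1 (Nat.find_min hex (by omega))⟩

lemma exists_zpow_smul_mem_Ioc (h : ∀ t ∈ uIcc a c, g • t < t) :
    ∃ k : ℤ, g ^ k • a ∈ Ioc (g • c) c := by
  rcases le_total c a with hca | hac
  · rw [uIcc_of_ge hca] at h
    obtain ⟨n, hlt, hle⟩ := exists_mem_Ioc_pow_smul hca h
    rcases hle.eq_or_lt with heq | hlt'
    · refine ⟨n, ?_⟩
      rw [zpow_natCast, ← heq]
      exact ⟨h c ⟨le_rfl, hca⟩, le_rfl⟩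
    · refine ⟨(n + 1 : ℕ), ?_⟩
      rw [zpow_natCast]
      refine ⟨?_, hlt.le⟩
      rw [pow_succ', mul_smul]
      exact smul_lt_smul_of_lt g hlt'
  · rw [uIcc_of_le hac] at h
    obtain ⟨n, hlt, hle⟩ := exists_mem_Ioc_pow_smul hac h
    have hlt' := smul_lt_smul_of_lt (g ^ n)⁻¹ hlt
    have hle' := smul_mono_right (g ^ n)⁻¹ hle
    rw [pow_succ, mul_smul, inv_smul_smul] at hlt'
    rw [inv_smul_smul] at hle'
    exact ⟨-n, by rw [zpow_neg, zpow_natCast]; exact ⟨hlt', hle'⟩⟩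

end MonotoneAction

section Ends

variable {V : Type*} {G : SimpleGraph V}

/-- A proper ray of a graph: a one-way infinite walk that eventually leaves every finite set of
vertices. It represents an end; unlike a ray in the usual sense it may revisit a vertex. -/
structure IsProperRay (G : SimpleGraph V) (r : ℕ → V) : Prop where
  tendsto_cofinite : Tendsto r atTop cofinite
  adj_succ : ∀ n, G.Adj (r n) (r (n + 1))

namespace IsProperRay

variable {r : ℕ → V}

lemma exists_componentCompl (hr : IsProperRay G r) {K : Set V} (hK : K.Finite) :
    ∃ C : G.ComponentCompl K, ∀ᶠ n in atTop, r n ∈ C := by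
  obtain ⟨N, hN⟩ :=
    eventually_atTop.1 (hr.tendsto_cofinite.eventually hK.eventually_cofinite_notMem)
  refine ⟨G.componentComplMk (hN N le_rfl), eventually_atTop.2 ⟨N, fun n hn => ?_⟩⟩
  induction n, hn using Nat.le_induction with
  | base => exact G.componentComplMk_mem _
  | succ n hn ih =>
    exact SimpleGraph.ComponentCompl.mem_of_adj _ _ ih (hN _ (by omega)) (hr.adj_succ n)

theorem exists_mem_end (hr : IsProperRay G r) :
    ∃ e ∈ G.end, ∀ K : (Finset V)ᵒᵖ, ∀ᶠ n in atTop, r n ∈ (e K).supp := by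
  choose e he using fun K : (Finset V)ᵒᵖ => hr.exists_componentCompl K.unop.finite_toSet
  refine ⟨e, fun {K L} f => ?_, he⟩
  obtain ⟨n, hnK, hnL⟩ := ((he K).and (he L)).exists
  have hLK := CategoryTheory.le_of_op_hom f
  exact ((e K).hom_eq_iff_not_disjoint hLK (e L)).2 (not_disjoint_iff.2 ⟨_, hnK, hnL⟩)

end IsProperRay

/-- The outer vertex boundary of a set `S` of vertices: the vertices outside `S` having a neighbour
in `S`. A set with finite outer boundary is cut off from the rest of the graph by a finite set. -/
def outerBoundary (G : SimpleGraph V) (S : Set V) : Set V :=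
  {v | v ∉ S ∧ ∃ u ∈ S, G.Adj u v}

lemma componentCompl_subset_of_outerBoundary_subset {K S : Set V} (hK : outerBoundary G S ⊆ K)
    {C : G.ComponentCompl K} {v : V} (hvC : v ∈ C) (hvS : v ∈ S) : (C : Set V) ⊆ S := by
  rintro w ⟨hwK, hwC⟩
  obtain ⟨hvK, rfl⟩ := hvC
  by_contra hwS
  obtain ⟨p⟩ := SimpleGraph.ConnectedComponent.exact hwC.symm
  obtain ⟨d, -, hfst, hsnd⟩ := p.exists_boundary_dart (Subtype.val ⁻¹' S) hvS hwS
  exact d.snd.2 (hK ⟨hsnd, d.fst, hfst, d.adj⟩)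

theorem infinite_end_of_pairwise_disjoint_rays {ι : Type*} [Infinite ι] {S : ι → Set V}
    {r : ι → ℕ → V} (hdisj : Pairwise (Function.onFun Disjoint S))
    (hfin : ∀ i, (outerBoundary G (S i)).Finite) (hr : ∀ i, IsProperRay G (r i))
    (hrS : ∀ i, ∀ᶠ n in atTop, r i n ∈ S i) : G.end.Infinite := by
  choose e he her using fun i => (hr i).exists_mem_end
  refine infinite_of_injective_forall_mem (f := e) (fun i j hij => ?_) he
  by_contra hne
  let K : (Finset V)ᵒᵖ := .op (hfin i).toFinset
  have hK : outerBoundary G (S i) ⊆ (K.unop : Set V) := (hfin i).coe_toFinset.superset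
  obtain ⟨m, hmC, hmS⟩ := ((her i K).and (hrS i)).exists
  obtain ⟨n, hnC, hnS⟩ := ((her j K).and (hrS j)).exists
  have hn : r j n ∈ S i :=
    componentCompl_subset_of_outerBoundary_subset hK hmC hmS (congrFun hij K ▸ hnC)
  exact disjoint_left.1 (hdisj hne) hn hnS

end Ends

section Schreier

variable {G M T V : Type*}

/-- The undirected graph underlying the Schreier graph of an arbitrary action, in which loops and
multiple edges are forgotten. -/
def schreierSimpleGraph (V : Type*) [SMul M V] (ι : T → M) :
    SimpleGraph (Quiver.SchreierGraph V ι) :=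
  SimpleGraph.fromRel fun a b => Nonempty (a ⟶ b)

lemma schreierSimpleGraph_adj [SMul M V] {ι : T → M} {a b : Quiver.SchreierGraph V ι} :
    (schreierSimpleGraph V ι).Adj a b ↔ a ≠ b ∧ ((∃ t, ι t • a = b) ∨ ∃ t, ι t • b = a) :=
  and_congr_right fun _ => or_congr nonempty_subtype nonempty_subtype

variable [Group G] [MulAction G V] {ι : T → G} {s : T}

lemma eq_and_eq_of_pow_smul_eq_pow_smul {g : G} {W : Set V}
    (hW : ∀ w ∈ W, ∀ n : ℕ, g ^ (n + 1) • w ∉ W) {v w : V} (hv : v ∈ W) (hw : w ∈ W) {m n : ℕ}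
    (h : g ^ m • v = g ^ n • w) : m = n ∧ v = w := by
  wlog hmn : m ≤ n generalizing m n v w
  · exact (this hw hv h.symm (by omega)).imp Eq.symm Eq.symm
  obtain ⟨k, rfl⟩ := Nat.exists_eq_add_of_le hmn
  rw [pow_add, mul_smul, smul_left_cancel_iff] at h
  cases k with
  | zero => exact ⟨rfl, by simpa only [pow_zero, one_smul] using h⟩
  | succ k => exact absurd (h ▸ hv) (hW w hw k)

lemma outerBoundary_range_pow_smul_subset {w : Quiver.SchreierGraph V ι}
    (hfix : ∀ n : ℕ, ∀ t ≠ s, ι t • ι s ^ n • w = ι s ^ n • w) :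
    outerBoundary (schreierSimpleGraph V ι) (range fun n : ℕ => ι s ^ n • w) ⊆
      {(ι s)⁻¹ • w} := by
  rintro b ⟨hb, _, ⟨n, rfl⟩, hadj⟩
  dsimp only at hadj
  rw [mem_singleton_iff]
  obtain ⟨hne, ⟨t, rfl⟩ | ⟨t, ht⟩⟩ := schreierSimpleGraph_adj.1 hadj
  · obtain rfl : t = s := of_not_not fun hts => hne (hfix n t hts).symm
    exact absurd ⟨n + 1, by simp only [pow_succ', mul_smul]⟩ hb
  · obtain rfl : t = s := of_not_not fun hts =>
      hne (MulAction.injective (ι t) ((hfix n t hts).trans ht.symm))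
    cases n with
    | zero => simpa only [pow_zero, one_smul, eq_inv_smul_iff] using ht
    | succ n =>
      rw [pow_succ', mul_smul, smul_left_cancel_iff] at ht
      exact absurd ⟨n, ht.symm⟩ hb

theorem infinite_end_schreierSimpleGraph_of_wandering {W : Set (Quiver.SchreierGraph V ι)}
    (hinf : W.Infinite)
    (hwander : ∀ w ∈ W, ∀ n : ℕ, ι s ^ (n + 1) • w ∉ W)
    (hfix : ∀ w ∈ W, ∀ n : ℕ, ∀ t ≠ s, ι t • ι s ^ n • w = ι s ^ n • w) :
    (schreierSimpleGraph V ι).end.Infinite := by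
  have : Infinite W := hinf.to_subtype
  refine infinite_end_of_pairwise_disjoint_rays (ι := W)
    (S := fun w => range fun n : ℕ => ι s ^ n • w.1) (r := fun w n => ι s ^ n • w.1)
    ?disjoint ?boundary ?ray fun _ => Eventually.of_forall mem_range_self
  case disjoint =>
    intro v w hne
    refine disjoint_left.2 ?_
    rintro _ ⟨m, rfl⟩ ⟨n, hn⟩
    exact hne (Subtype.ext (eq_and_eq_of_pow_smul_eq_pow_smul hwander w.2 v.2 hn).2.symm)
  case boundary =>
    exact fun w => (finite_singleton _).subset (outerBoundary_range_pow_smul_subset (hfix w w.2))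
  case ray =>
    intro w
    have hinj : Function.Injective fun n : ℕ => ι s ^ n • w.1 := fun _ _ h =>
      (eq_and_eq_of_pow_smul_eq_pow_smul hwander w.2 w.2 h).1
    refine ⟨Nat.cofinite_eq_atTop ▸ hinj.tendsto_cofinite,
      fun n => schreierSimpleGraph_adj.2 ⟨hinj.ne n.lt_succ_self.ne, .inl ⟨s, ?_⟩⟩⟩
    simp only [pow_succ', mul_smul]

end Schreier

namespace ThompsonF

instance : CovariantClass ThompsonF unitInterval HSMul.hSMul LE.le :=
  ⟨fun f _ _ h => f.2.1.monotone h⟩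

lemma coe_gen_zero_smul (t : unitInterval) : ((gen 0 • t : unitInterval) : ℝ) =
    if (t : ℝ) ≤ 1 / 2 then (t : ℝ) / 2 else if (t : ℝ) ≤ 3 / 4 then (t : ℝ) - 1 / 4
    else 2 * (t : ℝ) - 1 := rfl

lemma coe_gen_one_smul (t : unitInterval) : ((gen 1 • t : unitInterval) : ℝ) =
    if (t : ℝ) ≤ 1 / 2 then (t : ℝ) else if (t : ℝ) ≤ 3 / 4 then (t : ℝ) / 2 + 1 / 4
    else if (t : ℝ) ≤ 7 / 8 then (t : ℝ) - 1 / 8 else 2 * (t : ℝ) - 1 := rfl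

lemma gen_zero_smul_le (t : unitInterval) : gen 0 • t ≤ t := by
  rw [← Subtype.coe_le_coe, coe_gen_zero_smul]
  have h0 := t.2.1
  have h1 := t.2.2
  split_ifs <;> linarith

lemma gen_zero_smul_lt {t : unitInterval} (ht : t ∈ Ioo 0 1) : gen 0 • t < t := by
  have h0 : (0 : ℝ) < t := ht.1
  have h1 : (t : ℝ) < 1 := ht.2
  rw [← Subtype.coe_lt_coe, coe_gen_zero_smul]
  split_ifs <;> linarith

lemma gen_one_smul_of_le_half {t : unitInterval} (ht : (t : ℝ) ≤ 1 / 2) : gen 1 • t = t :=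
  Subtype.ext ((coe_gen_one_smul t).trans (if_pos ht))

lemma gen_one_smul_lt {t : unitInterval} (h : 1 / 2 < (t : ℝ)) (h1 : t < 1) : gen 1 • t < t := by
  have h1' : (t : ℝ) < 1 := h1
  rw [← Subtype.coe_lt_coe, coe_gen_one_smul]
  split_ifs <;> linarith

lemma coe_gen_one_smul_mem_Ioc {t : unitInterval} (ht : (t : ℝ) ∈ Ioc (1 / 2) (3 / 4)) :
    ((gen 1 • t : unitInterval) : ℝ) ∈ Ioc (1 / 2) (3 / 4) := by
  rw [coe_gen_one_smul, if_neg ht.1.not_ge, if_pos ht.2]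
  constructor <;> linarith [ht.1, ht.2]

lemma coe_gen_zero_smul_mem_Ioc {t : unitInterval} (ht : (t : ℝ) ∈ Ioc (1 / 2) (3 / 4)) :
    ((gen 0 • t : unitInterval) : ℝ) ∈ Ioc (1 / 4) (1 / 2) := by
  rw [coe_gen_zero_smul, if_neg ht.1.not_ge, if_pos ht.2]
  constructor <;> linarith [ht.1, ht.2]

lemma coe_gen_zero_smul_le_quarter {t : unitInterval} (ht : (t : ℝ) ≤ 1 / 2) :
    ((gen 0 • t : unitInterval) : ℝ) ≤ 1 / 4 := by
  rw [coe_gen_zero_smul, if_pos ht]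
  linarith

lemma coe_gen_zero_pow_smul_le_half {t : unitInterval} (ht : (t : ℝ) ≤ 1 / 2) (n : ℕ) :
    ((gen 0 ^ n • t : unitInterval) : ℝ) ≤ 1 / 2 :=
  (Subtype.coe_le_coe.2 (pow_smul_le (gen_zero_smul_le t) n)).trans ht

lemma exists_gen_zero_zpow_smul_mem_Ioc {t : unitInterval} (ht : t ∈ Ioo 0 1) :
    ∃ k : ℤ, ((gen 0 ^ k • t : unitInterval) : ℝ) ∈ Ioc (1 / 2) (3 / 4) := by
  let c : unitInterval := ⟨3 / 4, by norm_num⟩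
  have hc : c ∈ Ioo 0 1 :=
    ⟨show (0 : ℝ) < 3 / 4 by norm_num, show (3 / 4 : ℝ) < 1 by norm_num⟩
  have hgc : ((gen 0 • c : unitInterval) : ℝ) = 1 / 2 := by
    rw [coe_gen_zero_smul]
    norm_num [c]
  obtain ⟨k, hlt, hle⟩ := exists_zpow_smul_mem_Ioc (g := gen 0) (a := t) (c := c) fun _ hu =>
    gen_zero_smul_lt (ordConnected_Ioo.uIcc_subset ht hc hu)
  exact ⟨k, hgc ▸ Subtype.coe_lt_coe.2 hlt, hle⟩

variable {x : unitInterval}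

/-- The point of `[0,1]` underlying a vertex of the Schreier graph. -/
def point (v : SchreierGraphOf x) : unitInterval := v.toVertex

lemma point_injective : Function.Injective (point (x := x)) :=
  Subtype.val_injective.comp (Quiver.SchreierGraph.equiv _ _).symm.injective

lemma point_smul (f : ThompsonF) (v : SchreierGraphOf x) : point (f • v) = f • point v := rfl

lemma infinite_vertices_Ioc (hx : x ∈ Ioo 0 1) :
    {v : SchreierGraphOf x | (point v : ℝ) ∈ Ioc (1 / 4) (1 / 2)}.Infinite := by
  obtain ⟨k, hk⟩ := exists_gen_zero_zpow_smul_mem_Ioc hx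
  let v : SchreierGraphOf x := gen 0 ^ k • .ofVertex ⟨x, MulAction.mem_orbit_self x⟩
  have hmem (n : ℕ) : (point (gen 1 ^ n • v) : ℝ) ∈ Ioc (1 / 2) (3 / 4) := by
    induction n with
    | zero => rwa [pow_zero, one_smul]
    | succ n ih =>
      rw [pow_succ', mul_smul, point_smul]
      exact coe_gen_one_smul_mem_Ioc ih
  have hanti : StrictAnti fun n : ℕ => point (gen 1 ^ n • v) := by
    refine strictAnti_nat_of_succ_lt fun n => ?_
    rw [pow_succ', mul_smul, point_smul]
    exact gen_one_smul_lt (hmem n).1 (Subtype.coe_lt_coe.1 ((hmem n).2.trans_lt (by norm_num)))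
  exact infinite_of_injective_forall_mem (f := fun n : ℕ => gen 0 • gen 1 ^ n • v)
    ((MulAction.injective _).comp (Function.Injective.of_comp (f := point) hanti.injective))
    fun n => coe_gen_zero_smul_mem_Ioc (hmem n)

end ThompsonF

theorem mainTheorem12 (x : unitInterval) (hx : 0 < x ∧ x < 1) :
    (ThompsonF.underlyingGraph x).end.Infinite := by
  refine infinite_end_schreierSimpleGraph_of_wandering (s := 0)
    (ThompsonF.infinite_vertices_Ioc hx) ?wandering ?fixed
  case wandering =>
    intro w hw n hmem
    refine (ThompsonF.coe_gen_zero_smul_le_quarter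
      (ThompsonF.coe_gen_zero_pow_smul_le_half hw.2 n)).not_gt ?_
    rw [← mul_smul, ← pow_succ']
    exact hmem.1
  case fixed =>
    intro w hw n t ht
    obtain rfl := Fin.eq_one_of_ne_zero t ht
    exact ThompsonF.point_injective
      (ThompsonF.gen_one_smul_of_le_half (ThompsonF.coe_gen_zero_pow_smul_le_half hw.2 n))
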